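/- Call a finite simple graph planar if it can be drawn in the plane with its vertices as distinct points and its edges as simple arcs joining their endpoints, so that no vertex lies in the interior of an arc and the interiors of distinct arcs are disjoint. Call a graph unicyclic if it contains exactly one cycle. For integers $n, m \ge 0$ let $\mathcal{P}(n,m)$ be the set of all planar graphs on the labelled vertex set $\{1,\dots,n\}$ with exactly $m$ edges, and let $P_{n,m}$ be a graph chosen uniformly at random from $\mathcal{P}(n,m)$. Theorem. Let $H$ be a fixed (finite) connected unicyclic planar graph, let $A<1$ be a constant, and let $m=m(n)$ be a sequence of non-negative integers with $m(n)\le An$ for all $n$. Then $$\limsup_{n\to\infty}\ \mathbf{P}\bigl[P_{n,m(n)} \text{ contains a subgraph isomorphic to } H\bigr] < 1 .$$ -/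

import Mathlib

open Filter

namespace RandomPlanar

/-- The Euclidean plane. -/
abbrev Plane : Type := EuclideanSpace ℝ (Fin 2)

/-- A graph is planar if it can be drawn in the plane: the vertices are distinct points `pos v`,
each edge `e` is a simple arc `arc e` (an injective continuous image of `[0, 1]`) joining the
positions of its two endpoints, no vertex lies in the interior of an arc, and the interiors of
the arcs of distinct edges are disjoint. -/
def IsPlanar {V : Type*} (G : SimpleGraph V) : Prop :=
  ∃ (pos : V → Plane) (arc : G.edgeSet → C(unitInterval, Plane)),
    Function.Injective pos ∧
    (∀ e, Function.Injective (arc e)) ∧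
    (∀ e : G.edgeSet, Sym2.map pos e = s(arc e 0, arc e 1)) ∧
    (∀ (e : G.edgeSet) (t : unitInterval), 0 < t → t < 1 → ∀ v, arc e t ≠ pos v) ∧
    (∀ e f : G.edgeSet, e ≠ f → ∀ s t : unitInterval,
      0 < s → s < 1 → 0 < t → t < 1 → arc e s ≠ arc f t)

/-- A subgraph is a cycle if it is isomorphic to the cycle `C_k` for some `k ≥ 3`. -/
def IsCycleSubgraph {V : Type*} {G : SimpleGraph V} (C : G.Subgraph) : Prop :=
  ∃ k : ℕ, 3 ≤ k ∧ Nonempty (SimpleGraph.cycleGraph k ≃g C.coe)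

/-- A graph is unicyclic if exactly one of its subgraphs is a cycle. -/
def IsUnicyclic {V : Type*} (G : SimpleGraph V) : Prop :=
  ∃! C : G.Subgraph, IsCycleSubgraph C

/-- The set of all planar graphs on `n` labelled vertices with exactly `m` edges. -/
def planarGraphs (n m : ℕ) : Set (SimpleGraph (Fin n)) :=
  {G | IsPlanar G ∧ G.edgeSet.ncard = m}

/-- The probability that a graph chosen uniformly at random from `planarGraphs n m` has the
property `Q`. -/
noncomputable def planarProb (n m : ℕ) (Q : SimpleGraph (Fin n) → Prop) : ℝ :=
  ({G ∈ planarGraphs n m | Q G}.ncard : ℝ) / ((planarGraphs n m).ncard : ℝ)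

end RandomPlanar

/-!
The graph `H` contains a cycle of some length `k`, so it suffices to show that a constant proportion
of the planar graphs with `n` vertices and `m ≤ A n` edges has no `k`-cycle at all.

The engine is a switching argument. Take a planar graph with a `k`-cycle, remove the `k` edges of
the cycle, and add `k` edges elsewhere, each joining two different tree components. The positions of
the cycle can be recovered in at most `n ^ k` ways. On the other hand a graph with `m` edges has at
least `n - m ≥ (1 - A) n` tree components, so every insertion of an edge can be made in order
`n ^ 2` ways, and undone in at most order `n` ways; hence inserting `k` edges multiplies the number of
graphs by order `n ^ k` (`TreeJoinClosed.card_mul_pow_le`). The two effects balance up to a constant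
`C` independent of `n` (`TreeJoinClosed.sum_labelledCopyCount_le`). A new edge between different
components is a bridge and creates no cycle, while the removal destroys at least one `k`-cycle. This
has two consequences.

* The mean number of labelled `k`-cycles is at most `C`, so by Markov's inequality at least half of
  the graphs have at most `J` of them, where `J` is a constant.
* The number of graphs with exactly `j + 1` labelled `k`-cycles is at most `C` times the number of
  those with at most `j`. After `J` steps down, a proportion of at least `1 / (2 (1 + C) ^ J)` of
  all graphs has no `k`-cycle (`card_isPlanar_le`).

Only edges between tree components are inserted because this keeps the topological part elementary:
the new component is again a tree, which has a straight-line drawing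
(`exists_isStraightDrawing_of_isAcyclic`), and by compactness this drawing can be translated away
from a drawing of the rest (`isPlanar_of_separated`).
-/

namespace RandomPlanar

/-! ### Drawings -/

/-- `IsDrawing G pos arc` says that `pos` and `arc` draw `G` in the plane. The arcs are indexed by
all unordered pairs of vertices, but only those of edges of `G` are constrained; this makes it
possible to compare drawings of different graphs. -/
structure IsDrawing {V : Type*} (G : SimpleGraph V) (pos : V → Plane)
    (arc : Sym2 V → C(unitInterval, Plane)) : Prop where
  pos_injective : Function.Injective pos
  arc_injective : ∀ e ∈ G.edgeSet, Function.Injective (arc e)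
  map_pos : ∀ e ∈ G.edgeSet, Sym2.map pos e = s(arc e 0, arc e 1)
  arc_ne_pos : ∀ e ∈ G.edgeSet, ∀ t : unitInterval, 0 < t → t < 1 → ∀ v, arc e t ≠ pos v
  arc_ne_arc : ∀ e ∈ G.edgeSet, ∀ f ∈ G.edgeSet, e ≠ f → ∀ s t : unitInterval,
    0 < s → s < 1 → 0 < t → t < 1 → arc e s ≠ arc f t

theorem isPlanar_iff_exists_isDrawing {V : Type*} {G : SimpleGraph V} :
    IsPlanar G ↔ ∃ pos arc, IsDrawing G pos arc := by
  classical
  constructor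
  · rintro ⟨pos, arc, h1, h2, h3, h4, h5⟩
    refine ⟨pos, fun e => if h : e ∈ G.edgeSet then arc ⟨e, h⟩ else ContinuousMap.const _ 0,
      h1, ?_, ?_, ?_, ?_⟩
    · intro e he
      simpa [he] using h2 ⟨e, he⟩
    · intro e he
      simpa [he] using h3 ⟨e, he⟩
    · intro e he
      simpa [he] using h4 ⟨e, he⟩
    · intro e he f hf hef
      simpa [he, hf] using h5 ⟨e, he⟩ ⟨f, hf⟩ (by simpa using hef)
  · rintro ⟨pos, arc, h1, h2, h3, h4, h5⟩
    exact ⟨pos, fun e => arc e, h1, fun e => h2 e e.2, fun e => h3 e e.2, fun e => h4 e e.2,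
      fun e f hef => h5 e e.2 f f.2 (by simpa [Subtype.ext_iff] using hef)⟩

theorem IsPlanar.mono {V : Type*} {G G' : SimpleGraph V} (hle : G ≤ G') (h : IsPlanar G') :
    IsPlanar G := by
  rw [isPlanar_iff_exists_isDrawing] at h ⊢
  obtain ⟨pos, arc, h1, h2, h3, h4, h5⟩ := h
  have hs : ∀ e ∈ G.edgeSet, e ∈ G'.edgeSet := fun e he => SimpleGraph.edgeSet_mono hle he
  exact ⟨pos, arc, h1, fun e he => h2 e (hs e he), fun e he => h3 e (hs e he),
    fun e he => h4 e (hs e he), fun e he f hf => h5 e (hs e he) f (hs f hf)⟩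

theorem exists_norm_le_of_drawing {V : Type*} [Finite V] (pos : V → Plane)
    (arc : Sym2 V → C(unitInterval, Plane)) :
    ∃ R : ℝ, (∀ v, ‖pos v‖ ≤ R) ∧ ∀ e t, ‖arc e t‖ ≤ R := by
  have hfin : Bornology.IsBounded (Set.range pos ∪ ⋃ e, Set.range (arc e)) := by
    refine (Set.finite_range pos).isBounded.union ?_
    rw [Bornology.isBounded_iUnion]
    exact fun e => (isCompact_range (arc e).continuous).isBounded
  obtain ⟨R, hR⟩ := hfin.exists_norm_le
  exact ⟨R, fun v => hR _ (Or.inl ⟨v, rfl⟩),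
    fun e t => hR _ (Or.inr (Set.mem_iUnion.2 ⟨e, t, rfl⟩))⟩

/-- A graph without edges between `S` and its complement is planar as soon as its parts inside and
outside `S` are: after a translation the two drawings lie in disjoint bounded regions. -/
theorem isPlanar_of_separated {V : Type*} [Finite V] {G G₁ G₂ : SimpleGraph V} (S : Set V)
    (h₁ : IsPlanar G₁) (h₂ : IsPlanar G₂)
    (h : ∀ u v, G.Adj u v → (u ∉ S ∧ v ∉ S ∧ G₁.Adj u v) ∨ (u ∈ S ∧ v ∈ S ∧ G₂.Adj u v)) :
    IsPlanar G := by
  classical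
  rw [isPlanar_iff_exists_isDrawing] at h₁ h₂ ⊢
  obtain ⟨pos₁, arc₁, d₁⟩ := h₁
  obtain ⟨pos₂, arc₂, d₂⟩ := h₂
  obtain ⟨R₁, hp₁, ha₁⟩ := exists_norm_le_of_drawing pos₁ arc₁
  obtain ⟨R₂, hp₂, ha₂⟩ := exists_norm_le_of_drawing pos₂ arc₂
  obtain ⟨w, hw⟩ : ∃ w : Plane, R₁ + R₂ < ‖w‖ := NormedSpace.exists_lt_norm ℝ Plane _
  have hsep : ∀ x y : Plane, ‖x‖ ≤ R₁ → ‖y‖ ≤ R₂ → x ≠ y + w := by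
    rintro x y hx hy rfl
    have := norm_sub_le (y + w) y
    rw [add_sub_cancel_left] at this
    linarith
  have hcase : ∀ e ∈ G.edgeSet, ((∀ x ∈ e, x ∉ S) ∧ ¬ (∀ x ∈ e, x ∈ S) ∧ e ∈ G₁.edgeSet) ∨
      ((∀ x ∈ e, x ∈ S) ∧ e ∈ G₂.edgeSet) := by
    intro e
    induction e with | _ a b
    intro he
    rcases h a b he with ⟨ha, hb, hab⟩ | ⟨ha, hb, hab⟩
    · left; simp [ha, hb, hab]
    · right; simp [ha, hb, hab]
  refine ⟨fun v => if v ∈ S then pos₂ v + w else pos₁ v,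
    fun e => if ∀ x ∈ e, x ∈ S then arc₂ e + ContinuousMap.const _ w else arc₁ e,
    ?_, ?_, ?_, ?_, ?_⟩
  · intro a b hab
    by_cases ha : a ∈ S <;> by_cases hb : b ∈ S <;> simp only [ha, hb, if_true, if_false] at hab
    · exact d₂.pos_injective (add_right_cancel hab)
    · exact absurd hab.symm (hsep _ _ (hp₁ _) (hp₂ _))
    · exact absurd hab (hsep _ _ (hp₁ _) (hp₂ _))
    · exact d₁.pos_injective hab
  · intro e he
    rcases hcase e he with ⟨-, hS, he'⟩ | ⟨hS, he'⟩
    · rw [if_neg hS]; exact d₁.arc_injective e he'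
    · rw [if_pos hS]
      intro s t hst
      exact d₂.arc_injective e he' (add_right_cancel hst)
  · intro e he
    rcases hcase e he with ⟨hn, hS, he'⟩ | ⟨hS, he'⟩
    · rw [if_neg hS, ← d₁.map_pos e he']
      exact Sym2.map_congr fun x hx => if_neg (hn x hx)
    · rw [if_pos hS]
      have h1 : Sym2.map (fun v => if v ∈ S then pos₂ v + w else pos₁ v) e
          = Sym2.map (· + w) (Sym2.map pos₂ e) := by
        rw [Sym2.map_map]
        exact Sym2.map_congr fun x hx => if_pos (hS x hx)
      rw [h1, d₂.map_pos e he']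
      simp
  · intro e he t ht0 ht1 v
    rcases hcase e he with ⟨hn, hS, he'⟩ | ⟨hS, he'⟩
    · rw [if_neg hS]
      by_cases hv : v ∈ S
      · rw [if_pos hv]; exact hsep _ _ (ha₁ _ _) (hp₂ _)
      · rw [if_neg hv]; exact d₁.arc_ne_pos e he' t ht0 ht1 v
    · rw [if_pos hS]
      by_cases hv : v ∈ S
      · rw [if_pos hv]
        exact fun h => d₂.arc_ne_pos e he' t ht0 ht1 v (add_right_cancel h)
      · rw [if_neg hv]; exact (hsep _ _ (hp₁ _) (ha₂ _ _)).symm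
  · intro e he f hf hef s t hs0 hs1 ht0 ht1
    rcases hcase e he with ⟨-, hS, he'⟩ | ⟨hS, he'⟩ <;>
      rcases hcase f hf with ⟨-, hT, hf'⟩ | ⟨hT, hf'⟩
    · rw [if_neg hS, if_neg hT]
      exact d₁.arc_ne_arc e he' f hf' hef s t hs0 hs1 ht0 ht1
    · rw [if_neg hS, if_pos hT]; exact hsep _ _ (ha₁ _ _) (ha₂ _ _)
    · rw [if_pos hS, if_neg hT]; exact (hsep _ _ (ha₁ _ _) (ha₂ _ _)).symm
    · rw [if_pos hS, if_pos hT]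
      exact fun h => d₂.arc_ne_arc e he' f hf' hef s t hs0 hs1 ht0 ht1 (add_right_cancel h)

/-! ### Forests are planar -/

/-- `IsStraightDrawing G pos` says that placing the vertices at `pos` and drawing the edges as
line segments is a plane drawing of `G`. -/
structure IsStraightDrawing {V : Type*} (G : SimpleGraph V) (pos : V → Plane) : Prop where
  injective : Function.Injective pos
  notMem : ∀ a b, G.Adj a b → ∀ c, pos c ∉ openSegment ℝ (pos a) (pos b)
  disjoint : ∀ a b c d, G.Adj a b → G.Adj c d → s(a, b) ≠ s(c, d) →
    Disjoint (openSegment ℝ (pos a) (pos b)) (openSegment ℝ (pos c) (pos d))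

theorem lineMap_mem_openSegment_unitInterval (x y : Plane) (t : unitInterval) (h0 : 0 < t)
    (h1 : t < 1) : AffineMap.lineMap x y (t : ℝ) ∈ openSegment ℝ x y := by
  rw [openSegment_eq_image_lineMap]
  exact ⟨t, ⟨h0, h1⟩, rfl⟩

theorem IsStraightDrawing.isPlanar {V : Type*} {G : SimpleGraph V} {pos : V → Plane}
    (h : IsStraightDrawing G pos) : IsPlanar G := by
  rw [isPlanar_iff_exists_isDrawing]
  -- Each segment is parametrised starting from an arbitrarily chosen endpoint.
  have hmk : ∀ e : Sym2 V, s(e.out.1, e.out.2) = e := fun e => Quot.out_eq e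
  have hadj : ∀ e ∈ G.edgeSet, G.Adj e.out.1 e.out.2 := by
    intro e he
    rwa [← SimpleGraph.mem_edgeSet, hmk]
  refine ⟨pos, fun e => ⟨fun t => AffineMap.lineMap (pos e.out.1) (pos e.out.2) (t : ℝ), ?_⟩,
    h.injective, ?_, ?_, ?_, ?_⟩
  · exact AffineMap.lineMap_continuous.comp continuous_subtype_val
  · intro e he s t hst
    have hne : pos e.out.1 ≠ pos e.out.2 := fun hh => (hadj e he).ne (h.injective hh)
    exact Subtype.ext (AffineMap.lineMap_injective ℝ hne hst)
  · intro e he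
    conv_lhs => rw [← hmk e]
    simp
  · intro e he t h0 h1 v hv
    refine h.notMem _ _ (hadj e he) v ?_
    rw [← hv]
    exact lineMap_mem_openSegment_unitInterval _ _ t h0 h1
  · intro e he f hf hef s t hs0 hs1 ht0 ht1 hst
    refine Set.disjoint_left.1 (h.disjoint _ _ _ _ (hadj e he) (hadj f hf) ?_)
      (lineMap_mem_openSegment_unitInterval _ _ s hs0 hs1) ?_
    · rwa [hmk, hmk]
    · have := lineMap_mem_openSegment_unitInterval (pos f.out.1) (pos f.out.2) t ht0 ht1
      simp only [ContinuousMap.coe_mk] at hst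
      rwa [hst]

/-- Finitely many vectors leave a direction in the plane to which none of them is parallel. -/
theorem exists_direction_ne_smul {ι : Type*} [Finite ι] (q : ι → Plane) :
    ∃ d : Plane, d ≠ 0 ∧ ∀ i, ∀ r : ℝ, r ≠ 0 → q i ≠ r • d := by
  obtain ⟨y, hy⟩ := (Set.finite_range fun i => q i 1 / q i 0).exists_notMem
  refine ⟨!₂[1, y], fun h => ?_, fun i r hr h => hy ⟨i, ?_⟩⟩
  · simpa using congrArg (fun z : Plane => z 0) h
  · simp [h, hr]

/-- A short segment in general direction, issuing from the vertex `u`, meets the rest of a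
straight drawing only in `u`. -/
theorem IsStraightDrawing.exists_free_segment {V : Type*} [Finite V] {G : SimpleGraph V}
    {pos : V → Plane} (h : IsStraightDrawing G pos) (u : V) :
    ∃ p : Plane, p ≠ pos u ∧ ∀ q ∈ insert p (openSegment ℝ (pos u) p),
      (∀ w, q ≠ pos w) ∧ ∀ a b, G.Adj a b → q ∉ openSegment ℝ (pos a) (pos b) := by
  obtain ⟨d, hd, hdir⟩ := exists_direction_ne_smul fun w => pos w - pos u
  have hcont : Tendsto (fun t : ℝ => pos u + t • d) (nhdsWithin 0 (Set.Ioi 0)) (nhds (pos u)) := by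
    have : Continuous fun t : ℝ => pos u + t • d := by fun_prop
    have h0 := this.tendsto 0
    simp only [zero_smul, add_zero] at h0
    exact h0.mono_left nhdsWithin_le_nhds
  have hpos : ∀ᶠ t : ℝ in nhdsWithin 0 (Set.Ioi 0), 0 < t := eventually_mem_nhdsWithin
  have hev : ∀ᶠ t : ℝ in nhdsWithin 0 (Set.Ioi 0), (∀ w, pos u + t • d ≠ pos w) ∧
      ∀ a b, G.Adj a b → pos u + t • d ∉ openSegment ℝ (pos a) (pos b) := by
    have hray : ∀ t : ℝ, 0 < t → ∀ b, pos u + t • d ∉ openSegment ℝ (pos u) (pos b) := by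
      intro t ht b hmem
      rw [openSegment_eq_image'] at hmem
      obtain ⟨s, hs, hst⟩ := hmem
      refine hdir b (t / s) (div_pos ht hs.1).ne' ?_
      have h2 : s • (pos b - pos u) = t • d := add_left_cancel hst
      rw [div_eq_inv_mul, mul_smul, ← h2, smul_smul, inv_mul_cancel₀ hs.1.ne', one_smul]
    refine Eventually.and ?_ ?_
    · rw [eventually_all]
      intro w
      by_cases hw : w = u
      · filter_upwards [hpos] with t ht
        simp [hw, ht.ne', hd]
      · exact hcont.eventually_ne fun hh => hw (h.injective hh.symm)
    · rw [eventually_all]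
      intro a
      rw [eventually_all]
      intro b
      by_cases hab : G.Adj a b
      · by_cases ha : u = a
        · filter_upwards [hpos] with t ht _
          rw [← ha]
          exact hray t ht b
        by_cases hb : u = b
        · filter_upwards [hpos] with t ht _
          rw [← hb, openSegment_symm]
          exact hray t ht a
        have hcl : IsClosed (segment ℝ (pos a) (pos b)) := by
          rw [segment_eq_image_lineMap]
          exact (isCompact_Icc.image AffineMap.lineMap_continuous).isClosed
        have hu : pos u ∈ (segment ℝ (pos a) (pos b))ᶜ := by
          rw [← insert_endpoints_openSegment]
          simp only [Set.mem_compl_iff, Set.mem_insert_iff, not_or]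
          exact ⟨fun hh => ha (h.injective hh), fun hh => hb (h.injective hh), h.notMem a b hab u⟩
        filter_upwards [hcont (hcl.isOpen_compl.mem_nhds hu)] with t ht _ hmem
        exact ht (openSegment_subset_segment _ _ _ hmem)
      · exact Eventually.of_forall fun t hh => absurd hh hab
  obtain ⟨ε, hε, hsub⟩ := mem_nhdsGT_iff_exists_Ioo_subset.1 hev
  have hε' : (0 : ℝ) < ε := hε
  refine ⟨pos u + (ε / 2) • d, ?_, fun q hq => ?_⟩
  · simp [hd, hε'.ne']
  · obtain ⟨t, ht, rfl⟩ : ∃ t ∈ Set.Ioo (0 : ℝ) ε, pos u + t • d = q := by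
      rcases hq with rfl | hq
      · exact ⟨ε / 2, ⟨by linarith, by linarith⟩, rfl⟩
      · rw [openSegment_eq_image'] at hq
        obtain ⟨s, hs, rfl⟩ := hq
        refine ⟨s * (ε / 2), ⟨by have := hs.1; positivity, by nlinarith [hs.1, hs.2]⟩, ?_⟩
        simp [mul_smul]
    exact hsub ht

theorem exists_injective_plane (V : Type*) [Finite V] :
    ∃ pos : V → Plane, Function.Injective pos := by
  have := Fintype.ofFinite V
  have : Infinite Plane := EuclideanSpace.infinite
  exact ⟨fun v => Infinite.natEmbedding Plane (Fintype.equivFin V v),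
    (Infinite.natEmbedding Plane).injective.comp
      (Fin.val_injective.comp (Fintype.equivFin V).injective)⟩

theorem exists_leaf_of_isAcyclic {V : Type*} [Finite V] {G : SimpleGraph V} (hG : G.IsAcyclic)
    (hne : G ≠ ⊥) : ∃ v u, G.Adj v u ∧ ∀ w, G.Adj v w → w = u := by
  classical
  have := Fintype.ofFinite V
  obtain ⟨a, b, hab⟩ := SimpleGraph.ne_bot_iff_exists_adj.1 hne
  set C := G.connectedComponentMk a
  have ha : a ∈ C.supp := rfl
  have hb : b ∈ C.supp := C.mem_supp_of_adj_mem_supp ha hab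
  have : Nontrivial C := ⟨⟨a, ha⟩, ⟨b, hb⟩, by simpa [Subtype.ext_iff] using hab.ne⟩
  obtain ⟨v, hv⟩ := (hG.isTree_connectedComponent C).exists_vert_degree_one_of_nontrivial
  rw [SimpleGraph.degree_eq_one_iff_existsUnique_adj] at hv
  obtain ⟨u, hu, huniq⟩ := hv
  refine ⟨v, u, hu, fun w hw => ?_⟩
  exact congrArg Subtype.val (huniq ⟨w, C.mem_supp_of_adj_mem_supp v.2 hw⟩ hw)

/-- Forests have straight drawings: they are built by attaching leaves one at a time, and a leaf
can be attached by a short segment in general direction. -/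
theorem exists_isStraightDrawing_of_isAcyclic {V : Type*} [Finite V] {G : SimpleGraph V}
    (hG : G.IsAcyclic) : ∃ pos, IsStraightDrawing G pos := by
  classical
  induction hk : G.edgeSet.ncard using Nat.strong_induction_on generalizing G with
  | _ k ih =>
  by_cases hbot : G = ⊥
  · subst hbot
    obtain ⟨pos, hpos⟩ := exists_injective_plane V
    exact ⟨pos, hpos, by simp, by simp⟩
  obtain ⟨v, u, hvu, huniq⟩ := exists_leaf_of_isAcyclic hG hbot
  set G' := G.deleteEdges {s(v, u)} with hG'
  have hlt : G'.edgeSet.ncard < k := by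
    rw [← hk]
    refine Set.ncard_lt_ncard ?_ (Set.toFinite _)
    rw [hG', SimpleGraph.edgeSet_deleteEdges]
    exact Set.sdiff_singleton_ssubset.2 hvu
  obtain ⟨pos, hd⟩ := ih _ hlt (hG.anti (SimpleGraph.deleteEdges_le _)) rfl
  obtain ⟨p, hpu, hp⟩ := hd.exists_free_segment u
  have hsplit : ∀ a b, G.Adj a b → s(a, b) = s(u, v) ∨ (a ≠ v ∧ b ≠ v ∧ G'.Adj a b) := by
    intro a b hab
    by_cases ha : a = v
    · subst ha; left; rw [huniq b hab, Sym2.eq_swap]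
    by_cases hb : b = v
    · subst hb; left; rw [huniq a hab.symm]
    right
    refine ⟨ha, hb, ?_⟩
    rw [hG', SimpleGraph.deleteEdges_adj]
    refine ⟨hab, ?_⟩
    simp [ha, hb]
  have hv : Function.update pos v p v = p := Function.update_self ..
  have hn : ∀ a, a ≠ v → Function.update pos v p a = pos a := fun a ha =>
    Function.update_of_ne ha ..
  have huv : u ≠ v := hvu.ne'
  -- The edge at the leaf is the free segment, whichever way its ends are ordered.
  have hseg : ∀ a b, s(a, b) = s(u, v) →
      openSegment ℝ (Function.update pos v p a) (Function.update pos v p b)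
        = openSegment ℝ (pos u) p := by
    intro a b hab
    rcases Sym2.eq_iff.1 hab with ⟨rfl, rfl⟩ | ⟨rfl, rfl⟩
    · rw [hv, hn _ huv]
    · rw [hv, hn _ huv, openSegment_symm]
  have hdisj : ∀ a b c d, s(a, b) = s(u, v) → (c ≠ v ∧ d ≠ v ∧ G'.Adj c d) →
      Disjoint (openSegment ℝ (Function.update pos v p a) (Function.update pos v p b))
        (openSegment ℝ (Function.update pos v p c) (Function.update pos v p d)) := by
    intro a b c d hab ⟨hc, hd', hcd⟩
    rw [hseg a b hab, hn c hc, hn d hd', Set.disjoint_left]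
    exact fun q hq => (hp q (Or.inr hq)).2 c d hcd
  refine ⟨Function.update pos v p, ?_, ?_, ?_⟩
  · intro a b hab
    by_cases ha : a = v <;> by_cases hb : b = v
    · rw [ha, hb]
    · rw [ha, hv, hn b hb] at hab
      exact absurd hab ((hp p (Or.inl rfl)).1 b)
    · rw [hb, hv, hn a ha] at hab
      exact absurd hab.symm ((hp p (Or.inl rfl)).1 a)
    · rw [hn a ha, hn b hb] at hab
      exact hd.injective hab
  · intro a b hab c
    rcases hsplit a b hab with hs | ⟨ha, hb, hab'⟩
    · rw [hseg a b hs]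
      intro hmem
      by_cases hc : c = v
      · rw [hc, hv] at hmem
        exact hpu ((right_mem_openSegment_iff).1 hmem).symm
      · rw [hn c hc] at hmem
        exact (hp _ (Or.inr hmem)).1 c rfl
    · rw [hn a ha, hn b hb]
      by_cases hc : c = v
      · rw [hc, hv]; exact (hp p (Or.inl rfl)).2 a b hab'
      · rw [hn c hc]; exact hd.notMem a b hab' c
  · intro a b c d hab hcd hne
    rcases hsplit a b hab with hs | hs <;> rcases hsplit c d hcd with ht | ht
    · exact absurd (hs.trans ht.symm) hne
    · exact hdisj a b c d hs ht
    · exact (hdisj c d a b ht hs).symm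
    · rw [hn a hs.1, hn b hs.2.1, hn c ht.1, hn d ht.2.1]
      exact hd.disjoint a b c d hs.2.2 ht.2.2 hne

theorem isPlanar_of_isAcyclic {V : Type*} [Finite V] {G : SimpleGraph V} (hG : G.IsAcyclic) :
    IsPlanar G :=
  (exists_isStraightDrawing_of_isAcyclic hG).elim fun _ h => h.isPlanar

/-! ### Joining tree components -/

/-- The vertex `u` lies in a tree component of `G`. -/
def InTreeComponent {V : Type*} (G : SimpleGraph V) (u : V) : Prop :=
  (G.connectedComponentMk u).toSimpleGraph.IsAcyclic

theorem InTreeComponent.not_isCycle {V : Type*} {G : SimpleGraph V} {u w : V}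
    (hu : InTreeComponent G u) (hw : G.Reachable u w) (c : G.Walk w w) : ¬ c.IsCycle := by
  intro hc
  have hsupp : ∀ x ∈ c.support, x ∈ (G.connectedComponentMk u).supp := by
    intro x hx
    rw [SimpleGraph.ConnectedComponent.mem_supp_iff, SimpleGraph.ConnectedComponent.eq]
    classical
    exact (hw.trans (c.takeUntil x hx).reachable).symm
  have hind : (c.induce _ hsupp).IsCycle := by
    rw [← SimpleGraph.Walk.isCycle_map_iff_of_injective
      (f := (SimpleGraph.Embedding.induce (G := G) (G.connectedComponentMk u).supp).toHom)
      Subtype.val_injective, SimpleGraph.Walk.map_induce]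
    exact hc
  exact hu _ hind

/-- Joining two tree components by an edge preserves planarity: the new component is a tree and can
be drawn away from everything else. -/
theorem IsPlanar.sup_edge {V : Type*} [Finite V] {G : SimpleGraph V} (hG : IsPlanar G) {u v : V}
    (hu : InTreeComponent G u) (hv : InTreeComponent G v) (huv : ¬ G.Reachable u v) :
    IsPlanar (G ⊔ SimpleGraph.edge u v) := by
  let S : Set V := {w | G.Reachable u w ∨ G.Reachable v w}
  let F : SimpleGraph V :=
    { Adj := fun a b => a ∈ S ∧ b ∈ S ∧ G.Adj a b
      symm := ⟨fun _ _ h => ⟨h.2.1, h.1, h.2.2.symm⟩⟩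
      loopless := ⟨fun _ h => h.2.2.ne rfl⟩ }
  have hF : ∀ a b, F.Adj a b ↔ a ∈ S ∧ b ∈ S ∧ G.Adj a b := fun a b =>
    ⟨fun h => ⟨h.1, h.2.1, h.2.2⟩, fun h => ⟨h.1, h.2.1, h.2.2⟩⟩
  have hle : F ≤ G := fun a b hab => ((hF a b).1 hab).2.2
  have hacyc : F.IsAcyclic := by
    intro w c hc
    have hw : w ∈ S := by
      cases c with
      | nil => simp at hc
      | cons h p => exact ((hF _ _).1 h).1
    have hc' := hc.mapLe hle
    rcases hw with hw | hw
    · exact hu.not_isCycle hw _ hc'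
    · exact hv.not_isCycle hw _ hc'
  have hF' : (F ⊔ SimpleGraph.edge u v).IsAcyclic :=
    hacyc.sup_edge_of_not_reachable fun h => huv (h.mono hle)
  have hadj : ∀ a b, G.Adj a b → a ∈ S → b ∈ S := fun a b hab =>
    Or.imp (fun h => h.trans hab.reachable) (fun h => h.trans hab.reachable)
  refine isPlanar_of_separated S hG (isPlanar_of_isAcyclic hF') fun a b hab => ?_
  rw [SimpleGraph.sup_adj] at hab
  rcases hab with hab | hab
  · by_cases ha : a ∈ S
    · exact Or.inr ⟨ha, hadj a b hab ha, Or.inl ((hF a b).2 ⟨ha, hadj a b hab ha, hab⟩)⟩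
    · exact Or.inl ⟨ha, fun hb => ha (hadj b a hab.symm hb), hab⟩
  · right
    have hmem := hab
    rw [SimpleGraph.edge_adj] at hmem
    have huS : u ∈ S := Or.inl (SimpleGraph.Reachable.refl u)
    have hvS : v ∈ S := Or.inr (SimpleGraph.Reachable.refl v)
    refine ⟨?_, ?_, Or.inr hab⟩ <;> rcases hmem with ⟨⟨rfl, rfl⟩ | ⟨rfl, rfl⟩, -⟩ <;> assumption

/-! ### The number of tree components -/

open Classical in
/-- A graph with `n` vertices and `m` edges has at least `n - m` tree components, since a component
which is not a tree has at least as many edges as vertices. -/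
theorem card_le_ncard_edgeSet_add_card_tree_components {V : Type*} [Fintype V]
    (G : SimpleGraph V) :
    Fintype.card V ≤ G.edgeSet.ncard +
      (Finset.univ.filter fun C : G.ConnectedComponent => C.toSimpleGraph.IsAcyclic).card := by
  have hC : ∀ C : G.ConnectedComponent, 2 * Fintype.card C ≤
      (∑ v : C, G.degree v) + 2 * (if C.toSimpleGraph.IsAcyclic then 1 else 0) := by
    intro C
    have hdeg : ∑ v : C, G.degree v = 2 * Nat.card C.toSimpleGraph.edgeSet := by
      rw [Nat.card_eq_fintype_card, SimpleGraph.card_edgeSet,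
        ← SimpleGraph.sum_degrees_eq_twice_card_edges]
      refine Finset.sum_congr rfl fun v _ => ?_
      rw [SimpleGraph.ConnectedComponent.toSimpleGraph]
      refine (SimpleGraph.degree_induce_of_neighborSet_subset fun w hw => ?_).symm
      exact C.mem_supp_of_adj_mem_supp v.2 hw
    have hconn := C.connected_toSimpleGraph
    have hle := hconn.card_vert_le_card_edgeSet_add_one
    have hcard : Nat.card C = Fintype.card C := Nat.card_eq_fintype_card
    by_cases hac : C.toSimpleGraph.IsAcyclic
    · rw [if_pos hac]; omega
    · have hne : Nat.card C.toSimpleGraph.edgeSet + 1 ≠ Nat.card C := fun h =>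
        hac (SimpleGraph.isTree_iff_connected_and_card.2 ⟨hconn, h⟩).isAcyclic
      rw [if_neg hac]; omega
  have hsum := Finset.sum_le_sum fun C (_ : C ∈ Finset.univ) => hC C
  rw [Finset.sum_add_distrib, ← Finset.mul_sum, ← Finset.mul_sum, Finset.sum_boole] at hsum
  have h1 : ∑ C : G.ConnectedComponent, ∑ v : C, G.degree v = 2 * G.edgeSet.ncard := by
    rw [← Nat.card_coe_set_eq, Nat.card_eq_fintype_card, SimpleGraph.card_edgeSet,
        ← SimpleGraph.sum_degrees_eq_twice_card_edges]
    exact Fintype.sum_fiberwise G.connectedComponentMk fun v => G.degree v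
  have h2 : ∑ C : G.ConnectedComponent, Fintype.card C = Fintype.card V := by
    have := Fintype.sum_fiberwise G.connectedComponentMk fun _ : V => 1
    simp only [Finset.sum_const, Finset.card_univ, smul_eq_mul, mul_one] at this
    exact this
  rw [h1, h2] at hsum
  simp only [Nat.cast_id] at hsum
  omega

open Classical in
/-- The ordered pairs of vertices in different tree components. -/
noncomputable def treePairs {V : Type*} [Fintype V] (G : SimpleGraph V) : Finset (V × V) :=
  Finset.univ.filter fun p =>
    InTreeComponent G p.1 ∧ InTreeComponent G p.2 ∧ ¬ G.Reachable p.1 p.2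

theorem mul_le_card_treePairs {V : Type*} [Fintype V] (G : SimpleGraph V) (t : ℕ)
    (ht : t + G.edgeSet.ncard ≤ Fintype.card V) : t * (t - 1) ≤ (treePairs G).card := by
  classical
  set T := Finset.univ.filter fun C : G.ConnectedComponent => C.toSimpleGraph.IsAcyclic with hT
  have hTt : t ≤ T.card := by
    have := card_le_ncard_edgeSet_add_card_tree_components G
    have h2 : T.card = (Finset.univ.filter
      fun C : G.ConnectedComponent => C.toSimpleGraph.IsAcyclic).card := by rw [hT]
    omega
  have hcard : t * (t - 1) ≤ T.offDiag.card := by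
    rw [Finset.offDiag_card, ← Nat.mul_sub_one]
    exact Nat.mul_le_mul hTt (Nat.sub_le_sub_right hTt 1)
  refine hcard.trans (Finset.card_le_card_of_injOn (fun p => (p.1.out, p.2.out)) ?_ ?_)
  · rintro ⟨C, D⟩ hCD
    have hout : ∀ C : G.ConnectedComponent, G.connectedComponentMk C.out = C :=
      fun C => Quot.out_eq C
    have htree : ∀ C : G.ConnectedComponent, C.toSimpleGraph.IsAcyclic →
        InTreeComponent G C.out := by
      intro C hC
      rw [← hout C] at hC
      exact hC
    simp only [Finset.coe_offDiag, Set.mem_offDiag, Finset.mem_coe, hT, Finset.mem_filter,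
      Finset.mem_univ, true_and] at hCD
    refine Finset.mem_filter.2 ⟨Finset.mem_univ _, ?_, ?_, fun h => hCD.2.2 ?_⟩
    · exact htree C hCD.1
    · exact htree D hCD.2.1
    · rw [← hout C, ← hout D]
      exact SimpleGraph.ConnectedComponent.sound h
  · rintro ⟨C, D⟩ - ⟨C', D'⟩ - h
    simp only [Prod.mk.injEq] at h
    have hinj : Function.Injective fun C : G.ConnectedComponent => C.out :=
      Function.LeftInverse.injective (g := G.connectedComponentMk) fun C => Quot.out_eq C
    exact Prod.ext (hinj h.1) (hinj h.2)

/-! ### Counting graphs by inserting edges -/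

open Classical in
/-- The graphs on `V` with property `Q` and exactly `m` edges. -/
noncomputable def graphsWithEdges {V : Type*} [Fintype V] (Q : SimpleGraph V → Prop) (m : ℕ) :
    Finset (SimpleGraph V) :=
  Finset.univ.filter fun G => Q G ∧ G.edgeSet.ncard = m

theorem mem_graphsWithEdges {V : Type*} [Fintype V] {Q : SimpleGraph V → Prop} {m : ℕ}
    {G : SimpleGraph V} : G ∈ graphsWithEdges Q m ↔ Q G ∧ G.edgeSet.ncard = m := by
  simp [graphsWithEdges]

/-- The property `Q` survives joining two tree components by an edge. -/
def TreeJoinClosed {V : Type*} (Q : SimpleGraph V → Prop) : Prop :=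
  ∀ (G : SimpleGraph V) (u v : V), Q G → InTreeComponent G u → InTreeComponent G v →
    ¬ G.Reachable u v → Q (G ⊔ SimpleGraph.edge u v)

/-- Double counting of the pairs consisting of a graph with `m` edges and an edge joining two of its
tree components: the joined graph and the (oriented) new edge determine the original graph. -/
theorem TreeJoinClosed.card_mul_le {V : Type*} [Fintype V] {Q : SimpleGraph V → Prop}
    (hQ : TreeJoinClosed Q) {m t : ℕ} (ht : t + m ≤ Fintype.card V) :
    (graphsWithEdges Q m).card * (t * (t - 1)) ≤
      (graphsWithEdges Q (m + 1)).card * (2 * (m + 1)) := by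
  classical
  have h1 : (graphsWithEdges Q m).card * (t * (t - 1)) ≤
      ((graphsWithEdges Q m).sigma fun G => treePairs G).card := by
    rw [Finset.card_sigma, ← smul_eq_mul]
    refine Finset.card_nsmul_le_sum _ _ _ fun G hG => mul_le_card_treePairs G t ?_
    rwa [(mem_graphsWithEdges.1 hG).2]
  have h2 : ((graphsWithEdges Q (m + 1)).sigma fun G =>
      Finset.univ.filter fun p : V × V => G.Adj p.1 p.2).card =
      (graphsWithEdges Q (m + 1)).card * (2 * (m + 1)) := by
    rw [Finset.card_sigma]
    refine Finset.sum_const_nat fun G hG => ?_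
    rw [← (mem_graphsWithEdges.1 hG).2, ← SimpleGraph.coe_edgeFinset, Set.ncard_coe_finset,
      SimpleGraph.two_mul_card_edgeFinset]
  rw [← h2]
  refine h1.trans (Finset.card_le_card_of_injOn
    (fun x => ⟨x.1 ⊔ SimpleGraph.edge x.2.1 x.2.2, x.2⟩) ?_ ?_)
  · rintro ⟨G, u, v⟩ hx
    simp only [Finset.coe_sigma, Set.mem_sigma_iff, Finset.mem_coe, mem_graphsWithEdges, treePairs,
      Finset.mem_filter, Finset.mem_univ, true_and] at hx ⊢
    obtain ⟨⟨hG, hm⟩, hu, hv, huv⟩ := hx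
    have hne : u ≠ v := fun h => huv (h ▸ SimpleGraph.Reachable.refl u)
    refine ⟨⟨hQ G u v hG hu hv huv, ?_⟩, ?_⟩
    · rw [SimpleGraph.edgeSet_sup, SimpleGraph.edgeSet_edge_of_ne hne, Set.union_singleton,
        Set.ncard_insert_of_notMem (a := s(u, v)) (s := G.edgeSet)
          (fun h => huv (SimpleGraph.Adj.reachable h)) (Set.toFinite _), hm]
    · exact Or.inr (by simp [SimpleGraph.edge_adj, hne])
  · have hback : ∀ (G : SimpleGraph V) (u v : V), ¬ G.Reachable u v →
        (G ⊔ SimpleGraph.edge u v) \ SimpleGraph.edge u v = G := by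
      intro G u v h
      rw [sup_sdiff_right_self, SimpleGraph.sdiff_edge _ fun h' => h h'.reachable]
    rintro ⟨G, u, v⟩ hx ⟨G', u', v'⟩ hx' h
    simp only [Finset.coe_sigma, Set.mem_sigma_iff, Finset.mem_coe, treePairs,
      Finset.mem_filter] at hx hx'
    simp only [Sigma.mk.injEq, heq_eq_eq, Prod.mk.injEq] at h
    obtain ⟨h, rfl, rfl⟩ := h
    have := hback G u v hx.2.2.2.2
    rw [h, hback G' u v hx'.2.2.2.2] at this
    rw [this]

/-- As long as at most `(1 - a) * n` edges are present, at least `a * n` components are trees, so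
every additional edge multiplies the number of graphs in a family closed under joining tree
components by at least `a ^ 2 / 4 * n`. -/
theorem TreeJoinClosed.card_mul_pow_le {V : Type*} [Fintype V] {Q : SimpleGraph V → Prop}
    (hQ : TreeJoinClosed Q) {a : ℝ} (ha : 0 < a) (hV : 2 ≤ a * Fintype.card V) (m k : ℕ)
    (hm : ((m + k : ℕ) : ℝ) ≤ (1 - a) * Fintype.card V) :
    ((graphsWithEdges Q m).card : ℝ) * (a ^ 2 / 4 * Fintype.card V) ^ k ≤
      (graphsWithEdges Q (m + k)).card := by
  induction k with
  | zero => simp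
  | succ k ih =>
    set N : ℝ := (Fintype.card V : ℝ) with hN
    have hm' : (m : ℝ) + k + 1 ≤ (1 - a) * N := by push_cast at hm; linarith
    have hNpos : 0 < N := by
      by_contra hh
      nlinarith
    have ih := ih (by push_cast; linarith)
    have hle : m + k ≤ Fintype.card V := by
      have : ((m + k : ℕ) : ℝ) ≤ (Fintype.card V : ℝ) := by push_cast; nlinarith
      exact_mod_cast this
    have hstep := hQ.card_mul_le (m := m + k) (t := Fintype.card V - (m + k)) (by omega)
    set t : ℕ := Fintype.card V - (m + k) with ht
    have htN : (t : ℝ) = N - (m + k) := by rw [ht, Nat.cast_sub hle]; push_cast; rfl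
    have ht1 : 1 ≤ t := by
      have : (1 : ℝ) ≤ t := by rw [htN]; linarith
      exact_mod_cast this
    have hstep' : ((graphsWithEdges Q (m + k)).card : ℝ) * (t * (t - 1)) ≤
        (graphsWithEdges Q (m + k + 1)).card * (2 * (m + k + 1)) := by
      have := (Nat.cast_le (α := ℝ)).2 hstep
      push_cast [Nat.cast_sub ht1] at this
      linarith
    set x : ℝ := ((graphsWithEdges Q (m + k)).card : ℝ) with hx
    set y : ℝ := ((graphsWithEdges Q (m + k + 1)).card : ℝ) with hy
    have hx0 : 0 ≤ x := Nat.cast_nonneg _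
    have hy0 : 0 ≤ y := Nat.cast_nonneg _
    have htt : (a * N) * (a * N / 2) ≤ (t : ℝ) * (t - 1) := by
      apply mul_le_mul <;> first | (rw [htN]; linarith) | positivity
    have h1 : x * ((a * N) * (a * N / 2)) ≤ y * (2 * N) := by
      refine (mul_le_mul_of_nonneg_left htt hx0).trans (hstep'.trans ?_)
      refine mul_le_mul_of_nonneg_left ?_ hy0
      nlinarith
    have h2 : x * (a ^ 2 / 4 * N) ≤ y := by
      refine le_of_mul_le_mul_right ?_ (show 0 < 2 * N by positivity)
      linarith
    calc _ = ((graphsWithEdges Q m).card : ℝ) * (a ^ 2 / 4 * N) ^ k * (a ^ 2 / 4 * N) := by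
          rw [pow_succ, mul_assoc]
      _ ≤ x * (a ^ 2 / 4 * N) := mul_le_mul_of_nonneg_right ih (by positivity)
      _ ≤ y := h2

/-! ### Labelled copies under removal and addition of edges -/

theorem map_copy_le {W V : Type*} {A : SimpleGraph W} {G : SimpleGraph V} (f : A.Copy G) :
    A.map f.toEmbedding ≤ G := by
  rw [SimpleGraph.map_le_iff_le_comap]
  exact fun a b h => f.toHom.map_rel h

theorem ncard_edgeSet_sdiff_map_copy {W V : Type*} [Finite W] [Finite V] {A : SimpleGraph W}
    {G : SimpleGraph V} (f : A.Copy G) :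
    (G \ A.map f.toEmbedding).edgeSet.ncard + A.edgeSet.ncard = G.edgeSet.ncard := by
  have h : (A.map f.toEmbedding).edgeSet.ncard = A.edgeSet.ncard := by
    rw [SimpleGraph.edgeSet_map]
    exact Set.ncard_image_of_injective _ (Function.Embedding.injective _)
  rw [SimpleGraph.edgeSet_sdiff, ← h]
  exact Set.ncard_sdiff_add_ncard_of_subset (SimpleGraph.edgeSet_mono (map_copy_le f))
    (Set.toFinite _)

/-- Removing the edges of a labelled copy of `A` and remembering the labelling is injective. -/
theorem sum_labelledCopyCount_le {W V : Type*} [Fintype W] [Fintype V] {A : SimpleGraph W}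
    {Q Q' : SimpleGraph V → Prop}
    (hQ : ∀ (G : SimpleGraph V) (f : A.Copy G), Q G → Q' (G \ A.map f.toEmbedding)) (m : ℕ) :
    ∑ G ∈ graphsWithEdges Q (m + A.edgeSet.ncard), G.labelledCopyCount A ≤
      (graphsWithEdges Q' m).card * Fintype.card V ^ Fintype.card W := by
  classical
  have h1 : ∑ G ∈ graphsWithEdges Q (m + A.edgeSet.ncard), G.labelledCopyCount A =
      ((graphsWithEdges Q (m + A.edgeSet.ncard)).sigma fun G =>
        (Finset.univ : Finset (A.Copy G))).card := by
    rw [Finset.card_sigma]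
    refine Finset.sum_congr rfl fun G _ => ?_
    rw [SimpleGraph.labelledCopyCount, Finset.card_univ]
  have h2 : (graphsWithEdges Q' m ×ˢ (Finset.univ : Finset (W → V))).card =
      (graphsWithEdges Q' m).card * Fintype.card V ^ Fintype.card W := by
    rw [Finset.card_product, Finset.card_univ, Fintype.card_fun]
  rw [h1, ← h2]
  refine Finset.card_le_card_of_injOn (fun x => (x.1 \ A.map x.2.toEmbedding, x.2)) ?_ ?_
  · rintro ⟨G, f⟩ hx
    simp only [Finset.coe_sigma, Set.mem_sigma_iff, Finset.mem_coe, mem_graphsWithEdges] at hx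
    simp only [Finset.coe_product, Set.mem_prod, Finset.mem_coe, mem_graphsWithEdges,
      Finset.mem_univ, and_true]
    refine ⟨hQ G f hx.1.1, ?_⟩
    have := ncard_edgeSet_sdiff_map_copy f
    omega
  · rintro ⟨G, f⟩ - ⟨G', f'⟩ - h
    simp only [Prod.mk.injEq] at h
    obtain ⟨h, hf⟩ := h
    have hemb : f.toEmbedding = f'.toEmbedding := by
      ext w
      exact congrFun hf w
    have hG : G = G' := by
      rw [← sdiff_sup_cancel (map_copy_le f), ← sdiff_sup_cancel (map_copy_le f'), h, hemb]
    subst hG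
    rw [DFunLike.coe_injective hf]

theorem labelledCopyCount_eq_natCard {W V : Type*} [Fintype W] [Fintype V] (A : SimpleGraph W)
    (G : SimpleGraph V) : G.labelledCopyCount A = Nat.card (A.Copy G) := by
  classical
  rw [SimpleGraph.labelledCopyCount, Nat.card_eq_fintype_card]

theorem labelledCopyCount_sdiff_map_copy_lt {W V : Type*} [Fintype W] [Fintype V]
    {A : SimpleGraph W} {G : SimpleGraph V} (hA : A ≠ ⊥) (f : A.Copy G) :
    (G \ A.map f.toEmbedding).labelledCopyCount A < G.labelledCopyCount A := by
  classical
  obtain ⟨a, b, hab⟩ := SimpleGraph.ne_bot_iff_exists_adj.1 hA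
  rw [labelledCopyCount_eq_natCard, labelledCopyCount_eq_natCard, Nat.card_eq_fintype_card,
    Nat.card_eq_fintype_card]
  refine Fintype.card_lt_of_injective_of_notMem
    (fun f' : A.Copy (G \ A.map f.toEmbedding) =>
      (SimpleGraph.Copy.ofLE _ G sdiff_le).comp f') ?_ (b := f) ?_
  · intro f' f'' hff
    ext w
    exact DFunLike.congr_fun hff w
  · rintro ⟨f', hf'⟩
    have h : (G \ A.map f.toEmbedding).Adj (f' a) (f' b) := f'.toHom.map_rel hab
    have hval : ∀ w, f' w = f w := DFunLike.congr_fun hf'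
    rw [hval, hval, SimpleGraph.sdiff_adj] at h
    exact h.2 ((SimpleGraph.map_adj_apply (f := f.toEmbedding)).2 hab)

/-- A new edge between different components is a bridge, so it creates no copies of a bridgeless
graph. -/
theorem labelledCopyCount_sup_edge_le {W V : Type*} [Fintype W] [Fintype V] {A : SimpleGraph W}
    (hA : ∀ e ∈ A.edgeSet, ¬ A.IsBridge e) {G : SimpleGraph V} {u v : V}
    (huv : ¬ G.Reachable u v) :
    (G ⊔ SimpleGraph.edge u v).labelledCopyCount A ≤ G.labelledCopyCount A := by
  classical
  have key : ∀ (f : A.Copy (G ⊔ SimpleGraph.edge u v)) (a b : W), A.Adj a b →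
      G.Adj (f a) (f b) := by
    intro f a b hab
    by_contra hnot
    have hfab : (G ⊔ SimpleGraph.edge u v).Adj (f a) (f b) := f.toHom.map_rel hab
    have hedge : s(f a, f b) = s(u, v) := by
      have := (hfab.resolve_left hnot)
      rw [SimpleGraph.adj_edge] at this
      exact this.1.symm
    have hbr : (G ⊔ SimpleGraph.edge u v).IsBridge s(f a, f b) := by
      rw [hedge, SimpleGraph.isBridge_sup_edge]
      exact SimpleGraph.IsBridge.of_not_reachable huv
    refine hA s(a, b) hab fun hreach => hbr ?_
    let g : A.deleteEdges {s(a, b)} →g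
        (G ⊔ SimpleGraph.edge u v).deleteEdges {s(f a, f b)} :=
      { toFun := f
        map_rel' := by
          intro x y hxy
          rw [SimpleGraph.deleteEdges_adj] at hxy ⊢
          refine ⟨f.toHom.map_rel hxy.1, fun h => hxy.2 ?_⟩
          exact Sym2.map.injective f.injective (by simpa using h) }
    exact hreach.map g
  rw [labelledCopyCount_eq_natCard, labelledCopyCount_eq_natCard]
  refine Nat.card_le_card_of_injective
    (fun f => (⟨⟨f, fun {a b} h => key f a b h⟩, f.injective⟩ : A.Copy G)) ?_
  intro f f' hff
  ext w
  exact DFunLike.congr_fun hff w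

/-! ### Cycle graphs -/

theorem ncard_edgeSet_cycleGraph (n : ℕ) :
    (SimpleGraph.cycleGraph (n + 3)).edgeSet.ncard = n + 3 := by
  classical
  have h := (SimpleGraph.cycleGraph (n + 3)).sum_degrees_eq_twice_card_edges
  simp only [SimpleGraph.cycleGraph_degree_three_le, Finset.sum_const, Finset.card_univ,
    Fintype.card_fin, smul_eq_mul] at h
  rw [← SimpleGraph.coe_edgeFinset, Set.ncard_coe_finset]
  omega

theorem not_isBridge_cycleGraph (n : ℕ) :
    ∀ e ∈ (SimpleGraph.cycleGraph (n + 3)).edgeSet,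
      ¬ (SimpleGraph.cycleGraph (n + 3)).IsBridge e := by
  classical
  intro e he hbr
  have hc := SimpleGraph.cycleGraph.isCycle_cycle (n := n)
  refine hbr.notMem_edges_of_isCycle hc ?_
  -- The Hamiltonian cycle has as many edges as the graph.
  have hcard : (SimpleGraph.cycleGraph.cycle n).edges.toFinset.card = n + 3 := by
    rw [List.toFinset_card_of_nodup hc.isTrail.edges_nodup, SimpleGraph.Walk.length_edges,
      SimpleGraph.cycleGraph.length_cycle]
  have hsub : (SimpleGraph.cycleGraph.cycle n).edges.toFinset ⊆
      (SimpleGraph.cycleGraph (n + 3)).edgeFinset := by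
    intro x hx
    rw [SimpleGraph.mem_edgeFinset]
    exact SimpleGraph.Walk.edges_subset_edgeSet _ (List.mem_toFinset.1 hx)
  have heq := Finset.eq_of_subset_of_card_le hsub (by
    rw [hcard, ← Set.ncard_coe_finset, SimpleGraph.coe_edgeFinset, ncard_edgeSet_cycleGraph])
  rw [← List.mem_toFinset, heq, SimpleGraph.mem_edgeFinset]
  exact he

/-! ### Switching -/

/-- Planar graphs with at most `j` labelled copies of `A`. -/
def PlanarWithFewCopies {V W : Type*} [Fintype V] [Fintype W] (A : SimpleGraph W) (j : ℕ)
    (G : SimpleGraph V) : Prop :=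
  IsPlanar G ∧ G.labelledCopyCount A ≤ j

theorem treeJoinClosed_isPlanar {V : Type*} [Finite V] :
    TreeJoinClosed (IsPlanar : SimpleGraph V → Prop) :=
  fun _ _ _ hG hu hv huv => hG.sup_edge hu hv huv

theorem treeJoinClosed_planarWithFewCopies {V W : Type*} [Fintype V] [Fintype W]
    {A : SimpleGraph W} (hA : ∀ e ∈ A.edgeSet, ¬ A.IsBridge e) (j : ℕ) :
    TreeJoinClosed (PlanarWithFewCopies A j : SimpleGraph V → Prop) :=
  fun _ _ _ hG hu hv huv =>
    ⟨hG.1.sup_edge hu hv huv, (labelledCopyCount_sup_edge_le hA huv).trans hG.2⟩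

/-- Replacing the `k` edges of a copy of a graph `A` with `k` vertices and `k` edges by `k` edges
that join tree components: the `n ^ k` possible positions of the copy are outweighed, up to a
constant factor, by the number of ways to insert the new edges. -/
theorem TreeJoinClosed.sum_labelledCopyCount_le {V W : Type*} [Fintype V] [Fintype W]
    {A : SimpleGraph W} (hA : A.edgeSet.ncard = Fintype.card W) {Q Q' : SimpleGraph V → Prop}
    (hQ' : TreeJoinClosed Q')
    (hQ : ∀ (G : SimpleGraph V) (f : A.Copy G), Q G → Q' (G \ A.map f.toEmbedding))
    {a : ℝ} (ha : 0 < a) (hV : 2 ≤ a * Fintype.card V) (m : ℕ)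
    (hm : (m : ℝ) ≤ (1 - a) * Fintype.card V) :
    ((∑ G ∈ graphsWithEdges Q m, G.labelledCopyCount A : ℕ) : ℝ) ≤
      ((a ^ 2 / 4) ^ Fintype.card W)⁻¹ * (graphsWithEdges Q' m).card := by
  set k := Fintype.card W with hk
  rcases lt_or_ge m k with hmk | hmk
  · -- There are too few edges for a copy of `A`.
    have h0 : ∑ G ∈ graphsWithEdges Q m, G.labelledCopyCount A = 0 := by
      refine Finset.sum_eq_zero fun G hG => ?_
      rw [SimpleGraph.labelledCopyCount_eq_zero]
      rintro ⟨f⟩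
      have h1 := ncard_edgeSet_sdiff_map_copy f
      have h2 := (mem_graphsWithEdges.1 hG).2
      omega
    rw [h0, Nat.cast_zero]
    positivity
  · obtain ⟨l, rfl⟩ := Nat.exists_eq_add_of_le' hmk
    have hNpos : (0 : ℝ) < Fintype.card V := by
      by_contra hh
      have : (Fintype.card V : ℝ) = 0 := le_antisymm (not_lt.1 hh) (Nat.cast_nonneg _)
      rw [this] at hV
      linarith
    have h1 := hQ'.card_mul_pow_le ha hV l k hm
    have h2 := RandomPlanar.sum_labelledCopyCount_le hQ l
    rw [hA] at h2
    have h2' : ((∑ G ∈ graphsWithEdges Q (l + k), G.labelledCopyCount A : ℕ) : ℝ) ≤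
        (graphsWithEdges Q' l).card * (Fintype.card V : ℝ) ^ k := by
      exact_mod_cast h2
    rw [mul_pow] at h1
    have hb : 0 < (a ^ 2 / 4) ^ k := by positivity
    refine h2'.trans ?_
    rw [inv_mul_eq_div, le_div_iff₀ hb]
    linarith

/-! ### A constant proportion of graphs without cycles of a given length -/

/-- Pure counting: if `S j` counts the objects with at most `j` defects out of `N`, Markov's
inequality applies with mean `C`, and `S (j + 1) ≤ (1 + C) * S j`, then a constant proportion of
the objects has no defect. -/
theorem le_mul_pow_mul_of_markov {N C : ℝ} {S : ℕ → ℝ} {J : ℕ} (hC : 0 ≤ C) (hJ : 2 * C ≤ J + 1)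
    (hmarkov : (J + 1) * (N - S J) ≤ C * N) (hN : 0 ≤ N)
    (hstep : ∀ j, S (j + 1) ≤ (1 + C) * S j) : N ≤ 2 * (1 + C) ^ J * S 0 := by
  have hpow : ∀ j, S j ≤ (1 + C) ^ j * S 0 := by
    intro j
    induction j with
    | zero => simp
    | succ j ih =>
      calc S (j + 1) ≤ (1 + C) * S j := hstep j
        _ ≤ (1 + C) * ((1 + C) ^ j * S 0) := by gcongr
        _ = (1 + C) ^ (j + 1) * S 0 := by ring
  have hhalf : N - S J ≤ N / 2 := by
    have hJ0 : (0 : ℝ) < J + 1 := by positivity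
    refine le_of_mul_le_mul_left ?_ hJ0
    nlinarith
  have := hpow J
  linarith

/-- A constant proportion of the planar graphs with few edges contains no copy of a bridgeless graph
with equally many vertices and edges. -/
theorem card_isPlanar_le {V W : Type*} [Fintype V] [Fintype W] {A : SimpleGraph W} (hbot : A ≠ ⊥)
    (hA : A.edgeSet.ncard = Fintype.card W) (hbr : ∀ e ∈ A.edgeSet, ¬ A.IsBridge e)
    {a : ℝ} (ha : 0 < a) (hV : 2 ≤ a * Fintype.card V) (m : ℕ)
    (hm : (m : ℝ) ≤ (1 - a) * Fintype.card V) {C : ℝ}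
    (hC : C = ((a ^ 2 / 4) ^ Fintype.card W)⁻¹) {J : ℕ} (hJ : 2 * C ≤ J + 1) :
    ((graphsWithEdges (IsPlanar : SimpleGraph V → Prop) m).card : ℝ) ≤
      2 * (1 + C) ^ J *
        (graphsWithEdges (PlanarWithFewCopies A 0 : SimpleGraph V → Prop) m).card := by
  classical
  have hC0 : 0 ≤ C := by rw [hC]; positivity
  refine le_mul_pow_mul_of_markov
    (S := fun j => ((graphsWithEdges (PlanarWithFewCopies A j : SimpleGraph V → Prop) m).card : ℝ))
    hC0 hJ ?_ (Nat.cast_nonneg _) ?_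
  · have hsum := treeJoinClosed_isPlanar.sum_labelledCopyCount_le hA
      (Q := (IsPlanar : SimpleGraph V → Prop))
      (fun G f hG => hG.mono sdiff_le) ha hV m hm
    rw [← hC] at hsum
    refine le_trans ?_ hsum
    have hsub : graphsWithEdges (PlanarWithFewCopies A J : SimpleGraph V → Prop) m ⊆
        graphsWithEdges IsPlanar m := fun G hG => by
      rw [mem_graphsWithEdges] at hG ⊢
      exact ⟨hG.1.1, hG.2⟩
    rw [← Nat.cast_sub (Finset.card_le_card hsub), ← Finset.card_sdiff_of_subset hsub]
    have hmk : (graphsWithEdges (IsPlanar : SimpleGraph V → Prop) m \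
        graphsWithEdges (PlanarWithFewCopies A J) m).card • (J + 1) ≤
        ∑ G ∈ graphsWithEdges (IsPlanar : SimpleGraph V → Prop) m, G.labelledCopyCount A := by
      refine (Finset.card_nsmul_le_sum _ _ _ fun G hG => ?_).trans
        (Finset.sum_le_sum_of_subset Finset.sdiff_subset)
      rw [Finset.mem_sdiff, mem_graphsWithEdges, mem_graphsWithEdges] at hG
      by_contra hlt
      exact hG.2 ⟨⟨hG.1.1, by omega⟩, hG.1.2⟩
    have := (Nat.cast_le (α := ℝ)).2 hmk
    rw [smul_eq_mul, mul_comm] at this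
    exact_mod_cast this
  · intro j
    let Q : SimpleGraph V → Prop := fun G => IsPlanar G ∧ G.labelledCopyCount A = j + 1
    have hsum := (treeJoinClosed_planarWithFewCopies hbr j).sum_labelledCopyCount_le hA (Q := Q)
      (fun G f hG => ⟨hG.1.mono sdiff_le, by
        have := labelledCopyCount_sdiff_map_copy_lt hbot f
        have := hG.2
        omega⟩) ha hV m hm
    rw [← hC] at hsum
    have hcard : (graphsWithEdges Q m).card ≤
        ∑ G ∈ graphsWithEdges Q m, G.labelledCopyCount A := by
      rw [Finset.card_eq_sum_ones]
      refine Finset.sum_le_sum fun G hG => ?_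
      have := (mem_graphsWithEdges.1 hG).1.2
      omega
    have hsub : graphsWithEdges (PlanarWithFewCopies A (j + 1) : SimpleGraph V → Prop) m ⊆
        graphsWithEdges (PlanarWithFewCopies A j) m ∪ graphsWithEdges Q m := by
      intro G hG
      rw [Finset.mem_union, mem_graphsWithEdges, mem_graphsWithEdges]
      rw [mem_graphsWithEdges] at hG
      obtain ⟨⟨h1, h2⟩, h3⟩ := hG
      rcases Nat.lt_or_ge j (G.labelledCopyCount A) with h | h
      · exact Or.inr ⟨⟨h1, by omega⟩, h3⟩
      · exact Or.inl ⟨⟨h1, h⟩, h3⟩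
    have h1 := (Finset.card_le_card hsub).trans (Finset.card_union_le _ _)
    have h2 : ((graphsWithEdges (PlanarWithFewCopies A (j + 1) : SimpleGraph V → Prop) m).card : ℝ)
        ≤ (graphsWithEdges (PlanarWithFewCopies A j : SimpleGraph V → Prop) m).card +
          (graphsWithEdges Q m).card := by exact_mod_cast h1
    have h3 : ((graphsWithEdges Q m).card : ℝ) ≤
        ((∑ G ∈ graphsWithEdges Q m, G.labelledCopyCount A : ℕ) : ℝ) := by exact_mod_cast hcard
    linarith

/-! ### Probabilities -/

theorem IsUnicyclic.exists_cycleGraph_isContained {W : Type*} {H : SimpleGraph W}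
    (h : IsUnicyclic H) : ∃ k, SimpleGraph.IsContained (SimpleGraph.cycleGraph (k + 3)) H := by
  obtain ⟨C, ⟨k, hk, ⟨φ⟩⟩, -⟩ := h
  obtain ⟨l, rfl⟩ := Nat.exists_eq_add_of_le' hk
  exact ⟨l, ⟨C.coeCopy.comp φ.toCopy⟩⟩

/-- Graphs without a copy of `A ⊑ H` avoid `H`, so they bound the probability of containing `H` away
from one. The bound also holds if there are no planar graphs with `m` edges, when `planarProb` is
`0 / 0 = 0`. -/
theorem planarProb_le {W U : Type*} [Fintype U] {H : SimpleGraph W} {A : SimpleGraph U}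
    (hAH : A.IsContained H) {n m : ℕ} {K : ℝ} (hK : 1 ≤ K)
    (hcard : ((graphsWithEdges (IsPlanar : SimpleGraph (Fin n) → Prop) m).card : ℝ) ≤
      K * (graphsWithEdges (PlanarWithFewCopies A 0 : SimpleGraph (Fin n) → Prop) m).card) :
    planarProb n m (fun G => H.IsContained G) ≤ 1 - K⁻¹ := by
  classical
  have hP : (planarGraphs n m).ncard =
      (graphsWithEdges (IsPlanar : SimpleGraph (Fin n) → Prop) m).card := by
    rw [← Set.ncard_coe_finset]
    congr 1
    ext G
    rw [Finset.mem_coe, mem_graphsWithEdges]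
    rfl
  have hsum : {G ∈ planarGraphs n m | H.IsContained G}.ncard +
      (graphsWithEdges (PlanarWithFewCopies A 0 : SimpleGraph (Fin n) → Prop) m).card ≤
      (planarGraphs n m).ncard := by
    rw [← Set.ncard_coe_finset, ← Set.ncard_union_eq ?_ (Set.toFinite _) (Set.toFinite _)]
    · refine Set.ncard_le_ncard (Set.union_subset (fun G hG => hG.1) fun G hG => ?_)
        (Set.toFinite _)
      rw [Finset.mem_coe, mem_graphsWithEdges] at hG
      exact ⟨hG.1.1, hG.2⟩
    · rw [Set.disjoint_left]
      intro G hG hG'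
      rw [Finset.mem_coe, mem_graphsWithEdges] at hG'
      have := hG'.1.2
      rw [Nat.le_zero, SimpleGraph.labelledCopyCount_eq_zero] at this
      exact this (hAH.trans hG.2)
  have hsum' : (({G ∈ planarGraphs n m | H.IsContained G}.ncard : ℕ) : ℝ) +
      (graphsWithEdges (PlanarWithFewCopies A 0 : SimpleGraph (Fin n) → Prop) m).card ≤
      (planarGraphs n m).ncard := by exact_mod_cast hsum
  rw [← hP] at hcard
  have hK0 : 0 < K := by linarith
  unfold planarProb
  refine div_le_of_le_mul₀ (Nat.cast_nonneg _) (sub_nonneg.2 (inv_le_one_of_one_le₀ hK)) ?_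
  have : K⁻¹ * (planarGraphs n m).ncard ≤
      (graphsWithEdges (PlanarWithFewCopies A 0 : SimpleGraph (Fin n) → Prop) m).card := by
    rwa [inv_mul_le_iff₀ hK0]
  linarith

end RandomPlanar

theorem theorem5p2 {W : Type*} [Finite W] (H : SimpleGraph W)
    (hconn : H.Connected) (huni : RandomPlanar.IsUnicyclic H) (hplanar : RandomPlanar.IsPlanar H)
    (A : ℝ) (hA : A < 1) (m : ℕ → ℕ) (hm : ∀ n : ℕ, (m n : ℝ) ≤ A * n) :
    limsup (fun n : ℕ => RandomPlanar.planarProb n (m n) (fun G => SimpleGraph.IsContained H G))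
      atTop < 1 := by
  obtain ⟨k, hk⟩ := huni.exists_cycleGraph_isContained
  set C : ℝ := (((1 - A) ^ 2 / 4) ^ (k + 3))⁻¹ with hC
  have hC0 : 0 ≤ C := by positivity
  obtain ⟨J, hJ⟩ := exists_nat_ge (2 * C)
  set K : ℝ := 2 * (1 + C) ^ J with hK
  have hK1 : 1 ≤ K := by
    have : 1 ≤ (1 + C) ^ J := one_le_pow₀ (by linarith)
    linarith
  have hbot : SimpleGraph.cycleGraph (k + 3) ≠ ⊥ := fun h => by
    have := RandomPlanar.ncard_edgeSet_cycleGraph k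
    rw [h, SimpleGraph.edgeSet_bot, Set.ncard_empty] at this
    omega
  have hev : ∀ᶠ n : ℕ in atTop,
      RandomPlanar.planarProb n (m n) (fun G => SimpleGraph.IsContained H G) ≤ 1 - K⁻¹ := by
    filter_upwards [eventually_ge_atTop ⌈2 / (1 - A)⌉₊] with n hn
    have hn' : 2 ≤ (1 - A) * (Fintype.card (Fin n) : ℝ) := by
      rw [Fintype.card_fin, mul_comm, ← div_le_iff₀ (by linarith)]
      exact (Nat.le_ceil _).trans (by exact_mod_cast hn)
    refine RandomPlanar.planarProb_le hk hK1 ?_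
    refine RandomPlanar.card_isPlanar_le hbot ?_ (RandomPlanar.not_isBridge_cycleGraph k)
      (a := 1 - A) (by linarith) hn' (m n) ?_ ?_ ?_
    · rw [RandomPlanar.ncard_edgeSet_cycleGraph, Fintype.card_fin]
    · simpa using hm n
    · rw [Fintype.card_fin]
    · linarith
  have hlim : limsup (fun n : ℕ => RandomPlanar.planarProb n (m n)
      (fun G => SimpleGraph.IsContained H G)) atTop ≤ 1 - K⁻¹ := by
    -- Nonnegativity of probabilities makes the real-valued `limsup` meaningful.
    refine limsup_le_of_le ?_ hev
    refine IsCoboundedUnder.of_frequently_ge (a := 0) (Frequently.of_forall fun n => ?_)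
    unfold RandomPlanar.planarProb
    positivity
  have : 0 < K⁻¹ := inv_pos.2 (by linarith)
  linarith
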